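/- **Theorem 1.1.** Let $\mathbb K\in\{\mathbb R,\mathbb C\}$; all spaces are over $\mathbb K$. A basis $(e_n)_{n\ge 0}$ of a Banach space $X$ (every $x\in X$ can be written uniquely as $x=\sum_{n\ge0}x_ne_n$, $x_n\in\mathbb K$) is called *1-unconditional* if, for all finite sequences of scalars $(a_n)_{n=0}^N$, $(b_n)_{n=0}^N$ with $|b_n|\le|a_n|$ for all $n$, one has $\big\|\sum_{n=0}^N b_ne_n\big\|\le\big\|\sum_{n=0}^N a_ne_n\big\|$. For $\delta\in(0,1)$, a bounded operator $T$ on a Banach space $Z$ is called *$\delta$-hypercyclic* if there is $x\in Z$ such that for every non-zero $y\in Z$ there is an integer $n\ge0$ with $\|T^nx-y\|\le\delta\|y\|$. Let $X$ be a separable infinite-dimensional Banach space with a 1-unconditional basis. Let $Y$ be a separable infinite-dimensional Banach space with a 1-unconditional basis $(f_n)_{n\ge0}$ which is normalized ($\|f_n\|=1$ for all $n$) and whose backward shift $\sum_{n\ge0} y_nf_n\mapsto\sum_{n\ge0}y_{n+1}f_n$ is a well-defined continuous operator on $Y$. Let $$Z=\bigoplus_Y X=\Big\{(x_n)_{n\ge0}\in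 X^{\mathbb N}:\ \sum_{n\ge0}\|x_n\|_X f_n \text{ converges in } Y\Big\},\qquad \|(x_n)\|=\Big\|\sum_{n\ge0}\|x_n\|_X f_n\Big\|_Y,$$ which is a Banach space. Then for every $\varepsilon\in(0,1)$ there exists a bounded operator $T$ on $Z$ which is an operator-weighted backward shift, that is, $T(u_0,u_1,u_2,\dots)=(A_1u_1,A_2u_2,\dots)$ for some bounded operators $A_1,A_2,\dots$ on $X$, such that $T$ is not $\delta$-hypercyclic for any $\delta\in(0,\varepsilon)$ and $T$ is $\delta$-hypercyclic for every $\delta\in(\varepsilon,1)$. -/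

import Mathlib

open Filter Topology

section Unconditional

variable {𝕜 : Type*} [RCLike 𝕜] {E : Type*} [NormedAddCommGroup E] [NormedSpace 𝕜 E]

/-- The sequence `e` is `C`-unconditional: `‖∑ bₙ eₙ‖ ≤ C ‖∑ aₙ eₙ‖` for all finite sequences of
scalars with `|bₙ| ≤ |aₙ|` for every `n`. -/
def IsUnconditionalWith (𝕜 : Type*) [RCLike 𝕜] {E : Type*} [NormedAddCommGroup E]
    [NormedSpace 𝕜 E] (C : ℝ) (e : ℕ → E) : Prop :=
  ∀ (N : ℕ) (a b : ℕ → 𝕜), (∀ n < N, ‖b n‖ ≤ ‖a n‖) →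
    ‖∑ n ∈ Finset.range N, b n • e n‖ ≤ C * ‖∑ n ∈ Finset.range N, a n • e n‖

/-- The backward shift `∑ yₙ fₙ ↦ ∑ yₙ₊₁ fₙ` associated with the basis `f` is a (well-defined)
continuous operator. -/
def HasContinuousBackwardShift (f : SchauderBasis 𝕜 E) : Prop :=
  ∃ B : E →L[𝕜] E, B (f 0) = 0 ∧ ∀ n, B (f (n + 1)) = f n

theorem hasSum_conditional_iff {u : ℕ → E} {s : E} :
    HasSum u s (SummationFilter.conditional ℕ) ↔
      Tendsto (fun N => ∑ n ∈ Finset.range N, u n) atTop (𝓝 s) := by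
  rw [HasSum, SummationFilter.conditional_filter_eq_map_range, tendsto_map'_iff]
  rfl

theorem IsUnconditionalWith.summable_of_le [CompleteSpace E] {e : ℕ → E}
    (he : IsUnconditionalWith 𝕜 1 e) {a b : ℕ → 𝕜} (hab : ∀ n, ‖b n‖ ≤ ‖a n‖)
    (ha : Summable (fun n => a n • e n) (SummationFilter.conditional ℕ)) :
    Summable (fun n => b n • e n) (SummationFilter.conditional ℕ) := by
  obtain ⟨s, hs⟩ := ha
  rw [hasSum_conditional_iff] at hs
  have hc := hs.cauchySeq
  have key : CauchySeq (fun N => ∑ n ∈ Finset.range N, b n • e n) := by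
    rw [Metric.cauchySeq_iff'] at hc ⊢
    intro r hr
    obtain ⟨N, hN⟩ := hc r hr
    refine ⟨N, fun m hm => lt_of_le_of_lt ?_ (hN m hm)⟩
    have aux : ∀ c : ℕ → 𝕜,
        ∑ n ∈ Finset.range m, c n • e n - ∑ n ∈ Finset.range N, c n • e n =
          ∑ n ∈ Finset.range m, (if n < N then 0 else c n) • e n := by
      intro c
      rw [← Finset.sum_range_add_sum_Ico _ hm, add_sub_cancel_left,
        ← Finset.sum_range_add_sum_Ico _ hm, Finset.sum_eq_zero (s := Finset.range N), zero_add]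
      · refine Finset.sum_congr rfl fun n hn => ?_
        rw [if_neg (not_lt.2 (Finset.mem_Ico.1 hn).1)]
      · intro n hn
        rw [if_pos (Finset.mem_range.1 hn), zero_smul]
    rw [dist_eq_norm, dist_eq_norm, aux, aux]
    have := he m (fun n => if n < N then 0 else a n) (fun n => if n < N then 0 else b n)
      (fun n _ => by split_ifs <;> simp [hab])
    rwa [one_mul] at this
  obtain ⟨t, ht⟩ := cauchySeq_tendsto_of_complete key
  exact ⟨t, hasSum_conditional_iff.2 ht⟩

theorem IsUnconditionalWith.norm_le_of_le {e : ℕ → E}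
    (he : IsUnconditionalWith 𝕜 1 e) {a b : ℕ → 𝕜} (hab : ∀ n, ‖b n‖ ≤ ‖a n‖) {s t : E}
    (ha : HasSum (fun n => a n • e n) s (SummationFilter.conditional ℕ))
    (hb : HasSum (fun n => b n • e n) t (SummationFilter.conditional ℕ)) : ‖t‖ ≤ ‖s‖ := by
  rw [hasSum_conditional_iff] at ha hb
  refine le_of_tendsto_of_tendsto' hb.norm ha.norm fun N => ?_
  simpa using he N a b fun n _ => hab n

end Unconditional

section DirectSum

variable {𝕜 : Type*} [RCLike 𝕜] (X : Type*) [NormedAddCommGroup X] [NormedSpace 𝕜 X]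
  {Y : Type*} [NormedAddCommGroup Y] [NormedSpace 𝕜 Y] [CompleteSpace Y]
  (f : SchauderBasis 𝕜 Y) (hf : IsUnconditionalWith 𝕜 1 f)

/-- The sequences `(xₙ)` in `X` for which the series `∑ ‖xₙ‖ fₙ` converges in `Y` (convergence of
the partial sums `∑_{n < N} ‖xₙ‖ fₙ`), as a linear subspace of the space of all sequences. -/
def banachDirectSumSubmodule : Submodule 𝕜 (ℕ → X) where
  carrier := {x | Summable (fun n => ((‖x n‖ : ℝ) : 𝕜) • f n) (SummationFilter.conditional ℕ)}
  zero_mem' := by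
    simp
  add_mem' := by
    intro x y hx hy
    refine hf.summable_of_le (a := fun n => ((‖x n‖ : ℝ) : 𝕜) + ((‖y n‖ : ℝ) : 𝕜)) ?_ ?_
    · intro n
      rw [← RCLike.ofReal_add, RCLike.norm_ofReal, RCLike.norm_ofReal, abs_norm,
        abs_of_nonneg (by positivity)]
      exact norm_add_le _ _
    · simpa [add_smul] using! Summable.add hx hy
  smul_mem' := by
    intro c x hx
    refine hf.summable_of_le (a := fun n => c * ((‖x n‖ : ℝ) : 𝕜)) ?_ ?_
    · intro n
      simp [norm_smul]
    · simpa [mul_smul] using! Summable.const_smul c hx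

/-- The space `⨁_Y X` of all sequences `(xₙ)` in `X` such that `∑ ‖xₙ‖ fₙ` converges in `Y`. -/
def BanachDirectSum : Type _ := banachDirectSumSubmodule X f hf

namespace BanachDirectSum

noncomputable instance : AddCommGroup (BanachDirectSum X f hf) :=
  inferInstanceAs (AddCommGroup (banachDirectSumSubmodule X f hf))

noncomputable instance : Module 𝕜 (BanachDirectSum X f hf) :=
  inferInstanceAs (Module 𝕜 (banachDirectSumSubmodule X f hf))

instance : CoeFun (BanachDirectSum X f hf) (fun _ => ℕ → X) := ⟨fun x => x.1⟩

variable {X f hf}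

/-- The element `∑ ‖xₙ‖ fₙ` of `Y`. -/
noncomputable def normSeries (x : BanachDirectSum X f hf) : Y :=
  ∑'[SummationFilter.conditional ℕ] n, ((‖x n‖ : ℝ) : 𝕜) • f n

/-- The norm of `(xₙ)` is the norm of `∑ ‖xₙ‖ fₙ` in `Y`. -/
noncomputable instance : Norm (BanachDirectSum X f hf) := ⟨fun x => ‖normSeries x‖⟩

theorem norm_def (x : BanachDirectSum X f hf) : ‖x‖ = ‖normSeries x‖ := rfl

theorem hasSum_normSeries (x : BanachDirectSum X f hf) :
    HasSum (fun n => ((‖x n‖ : ℝ) : 𝕜) • f n) (normSeries x) (SummationFilter.conditional ℕ) :=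
  Summable.hasSum x.2

theorem coord_normSeries (x : BanachDirectSum X f hf) (i : ℕ) :
    f.coord i (normSeries x) = ((‖x i‖ : ℝ) : 𝕜) := by
  have h := (hasSum_conditional_iff.1 (hasSum_normSeries x))
  have h2 := ((f.coord i).continuous.tendsto _).comp h
  refine tendsto_nhds_unique h2 (tendsto_const_nhds.congr' ?_)
  filter_upwards [eventually_gt_atTop i] with N hN
  simp [f.ortho, Pi.single_apply, hN]

/-- The norm of `⨁_Y X` satisfies the axioms of a norm. -/
theorem normedSpaceCore : NormedSpace.Core 𝕜 (BanachDirectSum X f hf) where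
  norm_nonneg x := norm_nonneg (normSeries x)
  norm_smul c x := by
    have h : normSeries (c • x) = ((‖c‖ : ℝ) : 𝕜) • normSeries x := by
      refine HasSum.unique (hasSum_normSeries (c • x)) ?_
      convert! (hasSum_normSeries x).const_smul ((‖c‖ : ℝ) : 𝕜) using 2 with n
      rw [smul_smul, ← RCLike.ofReal_mul, ← norm_smul]
      rfl
    rw [norm_def, norm_def, h, norm_smul, RCLike.norm_ofReal, abs_norm]
  norm_triangle x y := by
    have h := (hasSum_normSeries x).add (hasSum_normSeries y)
    simp only [← add_smul] at h
    refine (IsUnconditionalWith.norm_le_of_le hf (fun n => ?_) h (hasSum_normSeries (x + y))).trans (norm_add_le _ _)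
    rw [← RCLike.ofReal_add, RCLike.norm_ofReal, RCLike.norm_ofReal, abs_norm,
      abs_of_nonneg (by positivity)]
    exact norm_add_le _ _
  norm_eq_zero_iff x := by
    constructor
    · intro h
      have h0 : normSeries x = 0 := norm_eq_zero.1 h
      refine Subtype.ext (funext fun i => ?_)
      have := coord_normSeries x i
      rw [h0, map_zero] at this
      exact norm_eq_zero.1 (RCLike.ofReal_eq_zero.1 this.symm)
    · rintro rfl
      refine norm_eq_zero.2 (HasSum.unique
        (hasSum_normSeries (0 : BanachDirectSum X f hf)) ?_)
      convert! (hasSum_zero : HasSum (fun _ : ℕ => (0 : Y)) 0 (SummationFilter.conditional ℕ))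
        using 2 with n
      have : ((0 : BanachDirectSum X f hf) : ℕ → X) n = 0 := rfl
      rw [this, norm_zero, RCLike.ofReal_zero, zero_smul]

noncomputable instance : NormedAddCommGroup (BanachDirectSum X f hf) :=
  NormedAddCommGroup.ofCore (normedSpaceCore (𝕜 := 𝕜) (X := X) (f := f) (hf := hf))

noncomputable instance : NormedSpace 𝕜 (BanachDirectSum X f hf) :=
  NormedSpace.ofCore (normedSpaceCore (X := X) (f := f) (hf := hf))

/-- `T` is an operator-weighted backward shift on `⨁_Y X`: for some bounded operators
`A₁, A₂, …` on `X`, `T (u₀, u₁, …) = (A₁ u₁, A₂ u₂, …)`. -/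
def IsWeightedBackwardShift (T : BanachDirectSum X f hf →L[𝕜] BanachDirectSum X f hf) : Prop :=
  ∃ A : ℕ → X →L[𝕜] X, ∀ (u : BanachDirectSum X f hf) (n : ℕ), (T u) n = A (n + 1) (u (n + 1))

end BanachDirectSum

end DirectSum

section Hypercyclic

variable {𝕜 : Type*} [RCLike 𝕜] {E : Type*} [NormedAddCommGroup E] [NormedSpace 𝕜 E]

/-- `x` is a `δ`-hypercyclic vector for `T`. -/
def IsDeltaHypercyclicVector (δ : ℝ) (T : E →L[𝕜] E) (x : E) : Prop :=
  ∀ y : E, y ≠ 0 → ∃ n : ℕ, ‖(T ^ n) x - y‖ ≤ δ * ‖y‖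

/-- `T` is `δ`-hypercyclic: it admits a `δ`-hypercyclic vector. -/
def IsDeltaHypercyclic (δ : ℝ) (T : E →L[𝕜] E) : Prop :=
  ∃ x : E, IsDeltaHypercyclicVector δ T x

end Hypercyclic

/-! Normalize the basis of `X`. The weights of `T` are `Qₙ Pₙ₊₁` with `Pₙ` invertible on `X`, `Qₙ =
Pₙ⁻¹` and `P₀ = 1`, so the products telescope: `(Tⁿ u)ⱼ = Qⱼ Pⱼ₊ₙ uⱼ₊ₙ`. Time is cut into stages `m
= 1, 2, …` of ages `0, …, m`. At age `τ > 0` of stage `m`, `Pₙ` fixes `e₀`, expands every `eᵢ` with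
`i ≠ 0, m` by `M 2^τ`, and sends `eₘ` to `2^τ (e₀ + sₘ eₘ)`. Here `sₘ` is tuned so that the distance
from `e₀` to the line `𝕜 (e₀ + sₘ eₘ)` is exactly `ε` (`exists_line_of_dist`).

Lower bound: a small vector can be sent near a large multiple of `e₀` only along that line, up to an
error of the size of the vector itself. So every `Pₙ` misses `b e₀` by at least `ε |b|` minus the
norm of the vector (`le_norm_smul_sub_growth`).

Upper bound: `Pₙ⁻¹` contracts by `4 · 2^(-τ)` on the hyperplane `wₘ = sₘ w₀` (`norm_growthInv_le`).
For a target `y` of finite support and a fresh large `m`, a correction of relative size `ε` puts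
each `Pⱼ yⱼ` in this hyperplane (`exists_coord_growth_eq`). Pulling back through a late age of stage
`m` then gives arbitrarily small vectors that some `Tⁿ` sends `ε`-close to `y`, and Baire's theorem
(`isDeltaHypercyclic_of_dense`) concludes. Boundedness of `T` holds because inside a stage the
weights are just `e₀ ↦ e₀`, `eᵢ ↦ 2 eᵢ`, and the inverse at the end of a stage is uniformly bounded
(`norm_growthInv_growth_stageNext_le`). -/

section Stages

/-! ### The timetable of stages and ages. -/

/-- Successor of a pair (age `τ`, stage `m`): the `m`-th stage has ages `0, …, m`. -/
def stageNext (p : ℕ × ℕ) : ℕ × ℕ := if p.1 < p.2 then (p.1 + 1, p.2) else (0, p.2 + 1)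

/-- The age and the stage at time `n`, starting with age `0` in stage `1`. -/
def stage : ℕ → ℕ × ℕ
  | 0 => (0, 1)
  | n + 1 => stageNext (stage n)

theorem stage_add {n m : ℕ} (h : stage n = (0, m)) : ∀ i ≤ m, stage (n + i) = (i, m)
  | 0, _ => h
  | i + 1, hi => by
    rw [← add_assoc, stage, stage_add h i (by omega), stageNext, if_pos (by simpa using hi)]

theorem exists_stage_eq (m : ℕ) : ∃ n, stage n = (0, m + 1) := by
  induction m with
  | zero => exact ⟨0, rfl⟩
  | succ m ih =>
    obtain ⟨n, hn⟩ := ih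
    refine ⟨n + (m + 1) + 1, ?_⟩
    rw [stage, stage_add hn _ le_rfl, stageNext, if_neg (by simp)]

/-- Guarantees that the distinguished vector `eₘ` of a stage is never `e₀`. -/
theorem stage_snd_pos (n : ℕ) : 0 < (stage n).2 := by
  induction n with
  | zero => simp [stage]
  | succ n ih =>
    rw [stage, stageNext]
    split_ifs <;> simp [ih]

end Stages

/-! ### Normalized 1-unconditional bases and coordinate estimates. -/

namespace SchauderBasis

variable {𝕜 : Type*} [RCLike 𝕜] {X : Type*} [NormedAddCommGroup X] [NormedSpace 𝕜 X]

theorem coord_apply_self (e : SchauderBasis 𝕜 X) (i : ℕ) : e.coord i (e i) = 1 := by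
  simp [e.ortho]

theorem coord_apply_of_ne (e : SchauderBasis 𝕜 X) {i j : ℕ} (h : i ≠ j) :
    e.coord i (e j) = 0 := by
  simp [e.ortho, h]

theorem basis_ne_zero (e : SchauderBasis 𝕜 X) (i : ℕ) : e i ≠ 0 := by
  intro h
  simpa [h] using e.coord_apply_self i

/-- The basis `eₙ / ‖eₙ‖`. -/
noncomputable def normalize (e : SchauderBasis 𝕜 X) : SchauderBasis 𝕜 X where
  basis i := ((‖e i‖ : ℝ) : 𝕜)⁻¹ • e i
  coord i := ((‖e i‖ : ℝ) : 𝕜) • e.coord i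
  ortho i j := by
    have h : ((‖e i‖ : ℝ) : 𝕜) ≠ 0 := by simp [e.basis_ne_zero i]
    by_cases hij : i = j
    · subst hij
      simp [e.ortho, h]
    · simp [e.ortho, hij]
  expansion x := by
    have h (i : ℕ) : ((‖e i‖ : ℝ) : 𝕜) ≠ 0 := by simp [e.basis_ne_zero i]
    convert! e.expansion x using 2 with i
    rw [smul_apply, smul_smul, smul_eq_mul, mul_right_comm,
      mul_inv_cancel₀ (h i), one_mul]

theorem norm_normalize (e : SchauderBasis 𝕜 X) (i : ℕ) : ‖e.normalize i‖ = 1 := by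
  have h : ‖e i‖ ≠ 0 := by simp [e.basis_ne_zero i]
  simp [normalize, norm_smul, h]

theorem isUnconditionalWith_normalize {e : SchauderBasis 𝕜 X} {C : ℝ}
    (he : IsUnconditionalWith 𝕜 C e) : IsUnconditionalWith 𝕜 C e.normalize := by
  intro N a b hab
  have := he N (fun n => a n * ((‖e n‖ : ℝ) : 𝕜)⁻¹) (fun n => b n * ((‖e n‖ : ℝ) : 𝕜)⁻¹)
    (fun n hn => by
      rw [norm_mul, norm_mul]
      exact mul_le_mul_of_nonneg_right (hab n hn) (norm_nonneg _))
  simpa [normalize, mul_smul] using this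

theorem norm_le_of_coord_le {e : SchauderBasis 𝕜 X} (he : IsUnconditionalWith 𝕜 1 e) {x y : X}
    (h : ∀ i, ‖e.coord i y‖ ≤ ‖e.coord i x‖) : ‖y‖ ≤ ‖x‖ :=
  he.norm_le_of_le h (e.expansion x) (e.expansion y)

theorem norm_coord_le {e : SchauderBasis 𝕜 X} (he : IsUnconditionalWith 𝕜 1 e)
    (hn : ∀ i, ‖e i‖ = 1) (i : ℕ) (x : X) : ‖e.coord i x‖ ≤ ‖x‖ := by
  have : ‖e.coord i x • e i‖ ≤ ‖x‖ := by
    refine norm_le_of_coord_le he fun j => ?_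
    by_cases hij : j = i
    · subst hij
      simp [coord_apply_self]
    · simp [coord_apply_of_ne e hij]
  simpa [norm_smul, hn] using this

theorem norm_add_le_of_coord_le {e : SchauderBasis 𝕜 X} (he : IsUnconditionalWith 𝕜 1 e)
    {i j : ℕ} (hij : i ≠ j) {a b : 𝕜} {x : X} (ha : ‖a‖ ≤ ‖e.coord i x‖)
    (hb : ‖b‖ ≤ ‖e.coord j x‖) : ‖a • e i + b • e j‖ ≤ ‖x‖ := by
  refine norm_le_of_coord_le he fun k => ?_
  by_cases hki : k = i
  · subst hki
    simpa [coord_apply_self, coord_apply_of_ne e hij] using ha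
  · by_cases hkj : k = j
    · subst hkj
      simpa [coord_apply_self, coord_apply_of_ne e hki] using hb
    · simp [coord_apply_of_ne e hki, coord_apply_of_ne e hkj]

/-- In the plane spanned by `e₀` and `eₘ` there is a line `𝕜 (e₀ + s eₘ)` whose distance to `e₀`
is exactly `ε`, and this distance is attained. -/
theorem exists_line_of_dist {e : SchauderBasis 𝕜 X} (he : IsUnconditionalWith 𝕜 1 e)
    (hn : ∀ i, ‖e i‖ = 1) {m : ℕ} (hm : 0 < m) {ε : ℝ} (hε0 : 0 < ε) (hε1 : ε < 1) :
    ∃ s a : 𝕜, ε ≤ ‖s‖ ∧ ‖s‖ ≤ ε / (1 - ε) ∧ ‖-(1 - a) • e 0 + (s * a) • e m‖ ≤ ε ∧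
      ∀ b c : 𝕜, ε * ‖b‖ ≤ ‖(b - c) • e 0 + (s * c) • e m‖ := by
  have h1ε : 0 < 1 - ε := by linarith
  let F : ℝ → ℝ → ℝ := fun s a => ‖((1 - a : ℝ) : 𝕜) • e 0 + ((s * a : ℝ) : 𝕜) • e m‖
  have hF : Continuous ↿F := by
    have : ↿F = fun p : ℝ × ℝ =>
        ‖((1 - p.2 : ℝ) : 𝕜) • e 0 + ((p.1 * p.2 : ℝ) : 𝕜) • e m‖ := rfl
    rw [this]
    fun_prop
  have hK : IsCompact (Set.Icc (0 : ℝ) 1) := isCompact_Icc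
  have hne : (Set.Icc (0 : ℝ) 1).Nonempty := ⟨0, by simp⟩
  have hψ := hK.continuous_sInf hF
  have hF0 : ∀ s a, 0 ≤ F s a := fun s a => norm_nonneg _
  have hbdd : ∀ s, BddBelow (F s '' Set.Icc 0 1) := fun s =>
    ⟨0, by rintro _ ⟨a, -, rfl⟩; exact hF0 s a⟩
  have hFc0 : ∀ s a, |1 - a| ≤ F s a := by
    intro s a
    have := norm_coord_le he hn 0 (((1 - a : ℝ) : 𝕜) • e 0 + ((s * a : ℝ) : 𝕜) • e m)
    rwa [map_add, map_smul, map_smul, coord_apply_self, coord_apply_of_ne e hm.ne, smul_zero,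
      add_zero, smul_eq_mul, mul_one, RCLike.norm_ofReal] at this
  have hFcm : ∀ s a, |s * a| ≤ F s a := by
    intro s a
    have := norm_coord_le he hn m (((1 - a : ℝ) : 𝕜) • e 0 + ((s * a : ℝ) : 𝕜) • e m)
    rwa [map_add, map_smul, map_smul, coord_apply_self, coord_apply_of_ne e hm.ne', smul_zero,
      zero_add, smul_eq_mul, mul_one, RCLike.norm_ofReal] at this
  have hψ0 : sInf (F 0 '' Set.Icc 0 1) ≤ ε := by
    refine (csInf_le (hbdd 0) ⟨1, by simp, rfl⟩).trans ?_
    simp [F, hε0.le]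
  have hψS : ε ≤ sInf (F (ε / (1 - ε)) '' Set.Icc 0 1) := by
    refine le_csInf (hne.image _) ?_
    rintro _ ⟨a, ha, rfl⟩
    -- For small `a` the `e₀`-coordinate `1 - a` is at least `ε`; otherwise the `eₘ`-coordinate `s
    -- a` is. The endpoint `ε / (1 - ε)` is chosen for this.
    by_cases h : a ≤ 1 - ε
    · exact le_trans (by linarith [le_abs_self (1 - a)]) (hFc0 _ a)
    · push Not at h
      refine le_trans ?_ ((le_abs_self _).trans (hFcm _ a))
      calc ε = ε / (1 - ε) * (1 - ε) := by field_simp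
        _ ≤ _ := by gcongr
  obtain ⟨s, hs, hsε⟩ : ε ∈ (fun s => sInf (F s '' Set.Icc 0 1)) '' Set.Icc 0 (ε / (1 - ε)) :=
    intermediate_value_Icc (by positivity) hψ.continuousOn ⟨hψ0, hψS⟩
  have hmin : ∀ a ∈ Set.Icc (0 : ℝ) 1, ε ≤ F s a := fun a ha =>
    hsε ▸ csInf_le (hbdd s) ⟨a, ha, rfl⟩
  obtain ⟨a, ha, haε⟩ : ε ∈ F s '' Set.Icc 0 1 := by
    have := (hK.image (f := F s) (by fun_prop)).sInf_mem (hne.image _)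
    rwa [show sInf (F s '' Set.Icc 0 1) = ε from hsε] at this
  refine ⟨(s : 𝕜), (a : 𝕜), ?_, ?_, ?_, ?_⟩
  -- At `a = 1` the vector is `s eₘ`, whose norm is `|s|`.
  · have := hmin 1 (by simp)
    simpa [F, norm_smul, hn] using this
  · rw [RCLike.norm_ofReal, abs_of_nonneg hs.1]
    exact hs.2
  · rw [← haε]
    refine norm_add_le_of_coord_le he hm.ne ?_ ?_
    · simp [coord_apply_self, coord_apply_of_ne e hm.ne, ← RCLike.ofReal_one (K := 𝕜),
        ← RCLike.ofReal_sub, norm_sub_rev, -map_sub, -map_one]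
    · simp [coord_apply_self, coord_apply_of_ne e hm.ne']
  · have key : ∀ c : 𝕜, ε ≤ ‖(1 - c) • e 0 + ((s : 𝕜) * c) • e m‖ := by
      intro c
      -- Unconditionality reduces a scalar `c` to the real parameter `min ‖c‖ 1`, which increases
      -- neither coordinate in modulus.
      refine (hmin (min ‖c‖ 1) ⟨le_min (norm_nonneg _) zero_le_one, min_le_right _ _⟩).trans ?_
      refine norm_add_le_of_coord_le he hm.ne ?_ ?_
      · have h1 : ‖((1 - min ‖c‖ 1 : ℝ) : 𝕜)‖ ≤ ‖1 - c‖ := by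
          rw [RCLike.norm_ofReal, abs_of_nonneg (by linarith [min_le_right ‖c‖ 1])]
          have := norm_sub_norm_le 1 c
          rw [norm_one] at this
          rcases min_cases ‖c‖ 1 with h | h
          · rw [h.1]; exact this
          · rw [h.1, sub_self]; exact norm_nonneg _
        simpa [coord_apply_self, coord_apply_of_ne e hm.ne, -map_sub] using h1
      · have h2 : |s| * |min ‖c‖ 1| ≤ |s| * ‖c‖ := by
          rw [abs_of_nonneg (le_min (norm_nonneg _) zero_le_one)]
          exact mul_le_mul_of_nonneg_left (min_le_left _ _) (abs_nonneg _)
        simpa [coord_apply_self, coord_apply_of_ne e hm.ne'] using h2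
    intro b c
    by_cases hb : b = 0
    · simp [hb]
    have : (b - c) • e 0 + ((s : 𝕜) * c) • e m =
        b • ((1 - c / b) • e 0 + ((s : 𝕜) * (c / b)) • e m) := by
      rw [smul_add, smul_smul, smul_smul]
      congr 2 <;> field_simp
    rw [this, norm_smul, mul_comm]
    exact mul_le_mul_of_nonneg_left (key _) (norm_nonneg _)

/-! ### Perturbations of scalar operators in the plane of `e₀` and `eₘ`. -/

/-- The operator with `e₀ ↦ (d + p) e₀`, `eₘ ↦ (d + r) eₘ + q e₀` and `eᵢ ↦ d eᵢ` for all other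
`i`. -/
noncomputable def scalarPerturb (e : SchauderBasis 𝕜 X) (m : ℕ) (d p q r : 𝕜) : X →L[𝕜] X :=
  d • ContinuousLinearMap.id 𝕜 X + (e.coord 0).smulRight (p • e 0) +
    (e.coord m).smulRight (q • e 0 + r • e m)

section ScalarPerturb

variable (e : SchauderBasis 𝕜 X) {m : ℕ} {d p q r : 𝕜}

theorem scalarPerturb_apply (v : X) :
    e.scalarPerturb m d p q r v =
      d • v + e.coord 0 v • p • e 0 + e.coord m v • (q • e 0 + r • e m) := by
  simp [scalarPerturb]

theorem coord_zero_scalarPerturb (hm : 0 < m) (v : X) :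
    e.coord 0 (e.scalarPerturb m d p q r v) = (d + p) * e.coord 0 v + q * e.coord m v := by
  simp only [scalarPerturb_apply, map_add, map_smul, smul_eq_mul, coord_apply_self,
    coord_apply_of_ne e hm.ne]
  ring

theorem coord_scalarPerturb_self (hm : 0 < m) (v : X) :
    e.coord m (e.scalarPerturb m d p q r v) = (d + r) * e.coord m v := by
  simp only [scalarPerturb_apply, map_add, map_smul, smul_eq_mul, coord_apply_self,
    coord_apply_of_ne e hm.ne']
  ring

theorem coord_scalarPerturb_of_ne {i : ℕ} (h0 : i ≠ 0) (hi : i ≠ m) (v : X) :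
    e.coord i (e.scalarPerturb m d p q r v) = d * e.coord i v := by
  simp only [scalarPerturb_apply, map_add, map_smul, smul_eq_mul,
    coord_apply_of_ne e h0, coord_apply_of_ne e hi]
  ring

theorem scalarPerturb_scalarPerturb (hm : 0 < m) {d' p' q' r' d'' p'' q'' r'' : 𝕜}
    (hd : d * d' = d'') (hp : (d + p) * (d' + p') = d'' + p'')
    (hq : (d + p) * q' + q * (d' + r') = q'') (hr : (d + r) * (d' + r') = d'' + r'') (v : X) :
    e.scalarPerturb m d p q r (e.scalarPerturb m d' p' q' r' v) =
      e.scalarPerturb m d'' p'' q'' r'' v := by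
  rw [e.scalarPerturb_apply, coord_zero_scalarPerturb e hm, coord_scalarPerturb_self e hm,
    scalarPerturb_apply, scalarPerturb_apply]
  obtain rfl := eq_sub_of_add_eq' hp.symm
  obtain rfl := eq_sub_of_add_eq' hr.symm
  subst hd hq
  module

theorem scalarPerturb_one (v : X) : e.scalarPerturb m 1 0 0 0 v = v := by
  simp [scalarPerturb_apply]

variable {e}

theorem norm_scalarPerturb_le (he : IsUnconditionalWith 𝕜 1 e) (hn : ∀ i, ‖e i‖ = 1) (v : X) :
    ‖e.scalarPerturb m d p q r v‖ ≤ (‖d‖ + ‖p‖ + ‖q‖ + ‖r‖) * ‖v‖ := by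
  rw [scalarPerturb_apply]
  have h0 := norm_coord_le he hn 0 v
  have hm := norm_coord_le he hn m v
  have hqr : ‖q • e 0 + r • e m‖ ≤ ‖q‖ + ‖r‖ := by
    refine (norm_add_le _ _).trans ?_
    simp [norm_smul, hn]
  calc _ ≤ ‖d • v‖ + ‖e.coord 0 v • p • e 0‖ + ‖e.coord m v • (q • e 0 + r • e m)‖ :=
        norm_add₃_le
    _ = ‖d‖ * ‖v‖ + ‖e.coord 0 v‖ * ‖p‖ + ‖e.coord m v‖ * ‖q • e 0 + r • e m‖ := by
        simp only [norm_smul, hn, mul_one]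
    _ ≤ ‖d‖ * ‖v‖ + ‖v‖ * ‖p‖ + ‖v‖ * (‖q‖ + ‖r‖) := by gcongr
    _ = _ := by ring

end ScalarPerturb

/-! ### The operators `Pₙ`, their inverses, and the three estimates. -/

section Growth

variable (e : SchauderBasis 𝕜 X) (M : 𝕜) (s : ℕ → 𝕜)

/-- The operator at age `τ` of stage `m`: the identity if `τ = 0`, and otherwise
`e₀ ↦ e₀`, `eₘ ↦ 2 ^ τ (e₀ + sₘ eₘ)`, and `eᵢ ↦ M 2 ^ τ eᵢ` for all other `i`. -/
noncomputable def growth (p : ℕ × ℕ) : X →L[𝕜] X :=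
  if p.1 = 0 then ContinuousLinearMap.id 𝕜 X else
    e.scalarPerturb p.2 (M * 2 ^ p.1) (1 - M * 2 ^ p.1) (2 ^ p.1) (2 ^ p.1 * s p.2 - M * 2 ^ p.1)

/-- The inverse of `SchauderBasis.growth`. -/
noncomputable def growthInv (p : ℕ × ℕ) : X →L[𝕜] X :=
  if p.1 = 0 then ContinuousLinearMap.id 𝕜 X else
    e.scalarPerturb p.2 (M * 2 ^ p.1)⁻¹ (1 - (M * 2 ^ p.1)⁻¹) (-(s p.2)⁻¹)
      ((2 ^ p.1 * s p.2)⁻¹ - (M * 2 ^ p.1)⁻¹)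

variable {M s}

theorem growth_growthInv (hM : M ≠ 0) (hs : ∀ m, 0 < m → s m ≠ 0) {p : ℕ × ℕ} (hp : 0 < p.2)
    (v : X) : e.growth M s p (e.growthInv M s p v) = v := by
  have hsp := hs _ hp
  rw [growth, growthInv]
  split_ifs
  · rfl
  · refine (scalarPerturb_scalarPerturb e hp (d'' := 1) (p'' := 0) (q'' := 0) (r'' := 0)
      ?_ ?_ ?_ ?_ v).trans (e.scalarPerturb_one v) <;> (field_simp <;> ring)

theorem growthInv_growth (hM : M ≠ 0) (hs : ∀ m, 0 < m → s m ≠ 0) {p : ℕ × ℕ} (hp : 0 < p.2)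
    (v : X) : e.growthInv M s p (e.growth M s p v) = v := by
  have hsp := hs _ hp
  rw [growth, growthInv]
  split_ifs
  · rfl
  · refine (scalarPerturb_scalarPerturb e hp (d'' := 1) (p'' := 0) (q'' := 0) (r'' := 0)
      ?_ ?_ ?_ ?_ v).trans (e.scalarPerturb_one v) <;> (field_simp <;> ring)

variable {e}

/-- Bounds the weights uniformly in time. The `e₀`-coefficient `-(sₘ)⁻¹` of the inverse does not
depend on the age, so inside a stage the off-diagonal terms cancel. The constant is the sum of the
bounds for entering age `1` and for leaving a stage. -/
theorem norm_growthInv_growth_stageNext_le (he : IsUnconditionalWith 𝕜 1 e)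
    (hn : ∀ i, ‖e i‖ = 1) (hM : 1 ≤ ‖M‖) {c S : ℝ} (hc : 0 < c)
    (hs : ∀ m, 0 < m → c ≤ ‖s m‖) (hS : ∀ m, 0 < m → ‖s m‖ ≤ S) {p : ℕ × ℕ} (hp : 0 < p.2)
    (v : X) :
    ‖e.growthInv M s p (e.growth M s (stageNext p) v)‖ ≤
      (6 * ‖M‖ + 2 * S + 2 * c⁻¹ + 7) * ‖v‖ := by
  have hM0 : M ≠ 0 := norm_pos_iff.1 (by linarith)
  have hs0 : s p.2 ≠ 0 := norm_pos_iff.1 (hc.trans_le (hs _ hp))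
  have hS0 : 0 ≤ S := (norm_nonneg _).trans (hS _ hp)
  have hcinv : 0 < c⁻¹ := inv_pos.2 hc
  rw [stageNext]
  split_ifs with h
  · by_cases h0 : p.1 = 0
    · rw [growthInv, growth, if_pos h0, if_neg (by simp), ContinuousLinearMap.id_apply]
      refine (norm_scalarPerturb_le he hn v).trans
        (mul_le_mul_of_nonneg_right ?_ (norm_nonneg _))
      have h1 : ‖M * 2 ^ (p.1 + 1)‖ = 2 * ‖M‖ := by simp [h0, mul_comm]
      have h2 : ‖(2 : 𝕜) ^ (p.1 + 1)‖ = 2 := by simp [h0]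
      have h3 := norm_sub_le (1 : 𝕜) (M * 2 ^ (p.1 + 1))
      have h4 := norm_sub_le ((2 : 𝕜) ^ (p.1 + 1) * s p.2) (M * 2 ^ (p.1 + 1))
      rw [norm_one] at h3
      rw [norm_mul _ (s p.2), h2] at h4
      have := hS _ hp
      dsimp only
      linarith
    · rw [growthInv, growth, if_neg h0, if_neg (by simp),
        scalarPerturb_scalarPerturb e hp (d'' := 2) (p'' := -1) (q'' := 0) (r'' := 0)]
      · refine (norm_scalarPerturb_le he hn v).trans
          (mul_le_mul_of_nonneg_right ?_ (norm_nonneg _))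
        simp only [RCLike.norm_ofNat, norm_neg, norm_one, norm_zero]
        linarith
      all_goals (dsimp only; field_simp; ring)
  · rw [growthInv, growth, if_pos rfl, ContinuousLinearMap.id_apply]
    split_ifs with h0
    · rw [ContinuousLinearMap.id_apply]
      refine le_mul_of_one_le_left (norm_nonneg _) ?_
      linarith
    · refine (norm_scalarPerturb_le he hn v).trans
        (mul_le_mul_of_nonneg_right ?_ (norm_nonneg _))
      have hpow : 1 ≤ ‖(2 : 𝕜) ^ p.1‖ := by
        rw [norm_pow, RCLike.norm_ofNat]
        exact one_le_pow₀ one_le_two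
      have h1 : ‖(M * 2 ^ p.1)⁻¹‖ ≤ 1 := by
        rw [norm_inv, norm_mul]
        exact inv_le_one_of_one_le₀ (one_le_mul_of_one_le_of_one_le hM hpow)
      have h2 : ‖(s p.2)⁻¹‖ ≤ c⁻¹ := by
        rw [norm_inv]
        exact inv_anti₀ hc (hs _ hp)
      have h3 : ‖(2 ^ p.1 * s p.2)⁻¹‖ ≤ c⁻¹ := by
        rw [norm_inv, norm_mul]
        exact inv_anti₀ hc ((hs _ hp).trans (le_mul_of_one_le_left (norm_nonneg _) hpow))
      have h4 := norm_sub_le (1 : 𝕜) (M * 2 ^ p.1)⁻¹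
      have h5 := norm_sub_le (2 ^ p.1 * s p.2)⁻¹ (M * 2 ^ p.1)⁻¹
      rw [norm_one] at h4
      rw [norm_neg]
      linarith

/-- Vectors on the line `𝕜 e₀` are badly approximated by the images of small vectors. -/
theorem le_norm_smul_sub_growth (he : IsUnconditionalWith 𝕜 1 e) (hn : ∀ i, ‖e i‖ = 1)
    {ε : ℝ} (hε : ε ≤ 1) {p : ℕ × ℕ} (hp : 0 < p.2)
    (hs : ∀ b c : 𝕜, ε * ‖b‖ ≤ ‖(b - c) • e 0 + (s p.2 * c) • e p.2‖) (b : 𝕜) (v : X) :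
    ε * ‖b‖ - ‖v‖ ≤ ‖e.growth M s p v - b • e 0‖ := by
  rw [norm_sub_rev]
  have h0 := norm_coord_le he hn 0 v
  rw [growth]
  split_ifs with h
  · have := norm_sub_norm_le (b • e 0) v
    rw [norm_smul, hn, mul_one] at this
    have hb : ε * ‖b‖ ≤ ‖b‖ := mul_le_of_le_one_left (norm_nonneg _) hε
    exact (by linarith : ε * ‖b‖ - ‖v‖ ≤ ‖b‖ - ‖v‖).trans this
  · set w := e.scalarPerturb p.2 (M * 2 ^ p.1) (1 - M * 2 ^ p.1) (2 ^ p.1)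
      (2 ^ p.1 * s p.2 - M * 2 ^ p.1) v with hw
    have hw0 : e.coord 0 w = e.coord 0 v + 2 ^ p.1 * e.coord p.2 v := by
      rw [hw, coord_zero_scalarPerturb e hp]; ring
    have hwm : e.coord p.2 w = s p.2 * (2 ^ p.1 * e.coord p.2 v) := by
      rw [hw, coord_scalarPerturb_self e hp]; ring
    -- Once `v₀ e₀` is removed, the part of `w` in the plane of `e₀` and `eₘ` lies on the line `𝕜
    -- (e₀ + sₘ eₘ)`.
    have key : ‖(b - 2 ^ p.1 * e.coord p.2 v) • e 0 + (s p.2 * (2 ^ p.1 * e.coord p.2 v)) • e p.2‖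
        ≤ ‖b • e 0 - w + e.coord 0 v • e 0‖ := by
      refine norm_add_le_of_coord_le he hp.ne (le_of_eq ?_) (le_of_eq ?_)
      · simp only [map_add, map_sub, map_smul, hw0, coord_apply_self, smul_eq_mul]
        congr 1
        ring
      · simp only [map_add, map_sub, map_smul, hwm, coord_apply_of_ne e hp.ne', smul_zero,
          zero_sub, add_zero, norm_neg]
    have h1 := (hs b _).trans (key.trans (norm_add_le _ _))
    rw [norm_smul, hn, mul_one] at h1
    linarith

/-- Every vector `y` without `m`-th coordinate can be corrected, by at most `ε ‖y‖`, so that its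
image lies in the hyperplane of vectors `w` with `wₘ = sₘ w₀`. -/
theorem exists_coord_growth_eq (he : IsUnconditionalWith 𝕜 1 e) (hn : ∀ i, ‖e i‖ = 1)
    {ε : ℝ} {a : 𝕜} {m : ℕ} (hm : 0 < m) (ha : ‖-(1 - a) • e 0 + (s m * a) • e m‖ ≤ ε)
    (hM : M ≠ 0) (hsM : 2 * ‖s m‖ ≤ ε * ‖M‖) {p : ℕ × ℕ} (hp : 0 < p.2) (hpm : p.2 ≠ m)
    {y : X} (hy : e.coord m y = 0) :
    ∃ y', ‖y' - y‖ ≤ ε * ‖y‖ ∧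
      e.coord m (e.growth M s p y') = s m * e.coord 0 (e.growth M s p y') := by
  have h0 := norm_coord_le he hn 0 y
  have h1 := norm_coord_le he hn p.2 y
  rw [growth]
  split_ifs with h
  -- At age `0` the operator is the identity: `y₀ e₀` is moved to its near-best approximation `a y₀
  -- (e₀ + sₘ eₘ)`, which costs `ε |y₀|`.
  · refine ⟨y + e.coord 0 y • (-(1 - a) • e 0 + (s m * a) • e m), ?_, ?_⟩
    · rw [add_sub_cancel_left, norm_smul, mul_comm ε]
      gcongr
    · simp only [ContinuousLinearMap.id_apply, map_add, map_smul, hy, coord_apply_self,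
        coord_apply_of_ne e hm.ne, coord_apply_of_ne e hm.ne', smul_eq_mul]
      ring
  · have h2 : (2 : 𝕜) ^ p.1 ≠ 0 := pow_ne_zero _ two_ne_zero
    -- At a positive age of another stage, `eₘ` is expanded by `M 2^τ`, so the required
    -- `eₘ`-coordinate is produced by a small multiple of `eₘ`.
    refine ⟨y + (s m * (e.coord 0 y + 2 ^ p.1 * e.coord p.2 y) / (M * 2 ^ p.1)) • e m, ?_, ?_⟩
    · rw [add_sub_cancel_left, norm_smul, hn, mul_one, norm_div, norm_mul, norm_mul,
        div_le_iff₀ (by positivity)]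
      have hpow : 1 ≤ ‖(2 : 𝕜) ^ p.1‖ := by
        rw [norm_pow, RCLike.norm_ofNat]
        exact one_le_pow₀ one_le_two
      have h3 : ‖e.coord 0 y + 2 ^ p.1 * e.coord p.2 y‖ ≤ 2 * ‖(2 : 𝕜) ^ p.1‖ * ‖y‖ := by
        refine (norm_add_le _ _).trans ?_
        rw [norm_mul]
        nlinarith [mul_le_mul_of_nonneg_left h1 (norm_nonneg ((2 : 𝕜) ^ p.1)),
          mul_le_mul_of_nonneg_right hpow (norm_nonneg y)]
      calc _ ≤ ‖s m‖ * (2 * ‖(2 : 𝕜) ^ p.1‖ * ‖y‖) := by gcongr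
        _ = 2 * ‖s m‖ * (‖(2 : 𝕜) ^ p.1‖ * ‖y‖) := by ring
        _ ≤ ε * ‖M‖ * (‖(2 : 𝕜) ^ p.1‖ * ‖y‖) := by gcongr
        _ = _ := by ring
    · rw [coord_zero_scalarPerturb e hp, coord_scalarPerturb_of_ne e hm.ne' hpm.symm]
      simp only [map_add, map_smul, hy, coord_apply_self, coord_apply_of_ne e hm.ne,
        coord_apply_of_ne e hpm, smul_eq_mul]
      field_simp
      ring

/-- On this hyperplane the plane component `w₀ (e₀ + sₘ eₘ)` is the image of `2^(-τ) w₀ eₘ`, and the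
other coordinates are divided by `M 2^τ`. No part of `w` has to come from the unexpanded vector
`e₀`. -/
theorem norm_growthInv_le (he : IsUnconditionalWith 𝕜 1 e) (hn : ∀ i, ‖e i‖ = 1)
    (hM : 1 ≤ ‖M‖) {p : ℕ × ℕ} (hp1 : p.1 ≠ 0) (hs : s p.2 ≠ 0) {w : X}
    (hw : e.coord p.2 w = s p.2 * e.coord 0 w) :
    ‖e.growthInv M s p w‖ ≤ 4 * (2⁻¹) ^ p.1 * ‖w‖ := by
  have h0 := norm_coord_le he hn 0 w
  have h1 := norm_coord_le he hn p.2 w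
  have hM0 : M ≠ 0 := norm_pos_iff.1 (by linarith)
  have hMi : ‖M⁻¹‖ ≤ 1 := by
    rw [norm_inv]
    exact inv_le_one_of_one_le₀ hM
  have heq : e.growthInv M s p w = ((2 : 𝕜)⁻¹) ^ p.1 • (M⁻¹ • w - (M⁻¹ * e.coord 0 w) • e 0 +
      (e.coord 0 w - M⁻¹ * e.coord p.2 w) • e p.2) := by
    rw [growthInv, if_neg hp1, scalarPerturb_apply, hw, inv_pow]
    match_scalars <;> field_simp
    ring
  rw [heq, norm_smul, norm_pow, norm_inv, RCLike.norm_ofNat, mul_comm (4 : ℝ), mul_assoc]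
  refine mul_le_mul_of_nonneg_left ?_ (by positivity)
  have b1 : ‖M⁻¹ • w‖ ≤ ‖w‖ := by
    rw [norm_smul]
    exact mul_le_of_le_one_left (norm_nonneg _) hMi
  have b2 : ‖(M⁻¹ * e.coord 0 w) • e 0‖ ≤ ‖w‖ := by
    rw [norm_smul, hn, mul_one, norm_mul]
    exact (mul_le_of_le_one_left (norm_nonneg _) hMi).trans h0
  have b3 : ‖(e.coord 0 w - M⁻¹ * e.coord p.2 w) • e p.2‖ ≤ 2 * ‖w‖ := by
    rw [norm_smul, hn, mul_one]
    refine (norm_sub_le _ _).trans ?_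
    rw [norm_mul]
    have := mul_le_of_le_one_left (norm_nonneg (e.coord p.2 w)) hMi
    linarith
  have b4 := norm_add_le (M⁻¹ • w - (M⁻¹ * e.coord 0 w) • e 0)
    ((e.coord 0 w - M⁻¹ * e.coord p.2 w) • e p.2)
  have b5 := norm_sub_le (M⁻¹ • w) ((M⁻¹ * e.coord 0 w) • e 0)
  linarith

end Growth

end SchauderBasis

/-! ### The backward shift of `Y` in coordinates, and the geometry of the direct sum. -/

theorem HasContinuousBackwardShift.exists_coord {𝕜 : Type*} [RCLike 𝕜] {Y : Type*}
    [NormedAddCommGroup Y] [NormedSpace 𝕜 Y] {f : SchauderBasis 𝕜 Y}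
    (h : HasContinuousBackwardShift f) :
    ∃ B : Y →L[𝕜] Y, ∀ y n, f.coord n (B y) = f.coord (n + 1) y := by
  obtain ⟨B, hB0, hB⟩ := h
  refine ⟨B, fun y n => ?_⟩
  have hbasis : ∀ i, f.coord n (B (f i)) = f.coord (n + 1) (f i) := by
    rintro (_ | i)
    · simp [hB0, f.ortho]
    · simp [hB, f.ortho, Pi.single_apply]
  have h1 := ((f.coord n ∘L B).continuous.tendsto y).comp (SchauderBasis.tendsto_proj f y)
  have h2 := ((f.coord (n + 1)).continuous.tendsto y).comp (SchauderBasis.tendsto_proj f y)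
  refine tendsto_nhds_unique h1 (h2.congr fun N => ?_)
  simp [hbasis]

namespace BanachDirectSum

variable {𝕜 : Type*} [RCLike 𝕜] {X : Type*} [NormedAddCommGroup X] [NormedSpace 𝕜 X]
  {Y : Type*} [NormedAddCommGroup Y] [NormedSpace 𝕜 Y] [CompleteSpace Y]
  {f : SchauderBasis 𝕜 Y} {hf : IsUnconditionalWith 𝕜 1 f}

theorem ext {u v : BanachDirectSum X f hf} (h : ∀ n, u n = v n) : u = v :=
  Subtype.ext (funext h)

variable (f hf) in
/-- The `n`-th coordinate, as a linear map. -/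
noncomputable def coordₗ (n : ℕ) : BanachDirectSum X f hf →ₗ[𝕜] X where
  toFun u := u n
  map_add' _ _ := rfl
  map_smul' _ _ := rfl

theorem add_apply (u v : BanachDirectSum X f hf) (n : ℕ) : (u + v) n = u n + v n := rfl

theorem sub_apply (u v : BanachDirectSum X f hf) (n : ℕ) : (u - v) n = u n - v n := rfl

theorem smul_apply (c : 𝕜) (u : BanachDirectSum X f hf) (n : ℕ) : (c • u) n = c • u n := rfl

theorem zero_apply (n : ℕ) : (0 : BanachDirectSum X f hf) n = 0 := rfl

theorem sum_apply {ι : Type*} (t : Finset ι) (u : ι → BanachDirectSum X f hf) (n : ℕ) :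
    (∑ i ∈ t, u i) n = ∑ i ∈ t, u i n :=
  map_sum (coordₗ f hf n) u t

theorem norm_coord_normSeries (u : BanachDirectSum X f hf) (n : ℕ) :
    ‖f.coord n (normSeries u)‖ = ‖u n‖ := by
  rw [coord_normSeries, RCLike.norm_ofReal, abs_norm]

theorem norm_le_of_le_coord {u : BanachDirectSum X f hf} {y : Y}
    (h : ∀ n, ‖u n‖ ≤ ‖f.coord n y‖) : ‖u‖ ≤ ‖y‖ :=
  SchauderBasis.norm_le_of_coord_le hf fun n => (norm_coord_normSeries u n).trans_le (h n)

theorem norm_le_mul_norm {u v : BanachDirectSum X f hf} {c : ℝ} (hc : 0 ≤ c)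
    (h : ∀ n, ‖u n‖ ≤ c * ‖v n‖) : ‖u‖ ≤ c * ‖v‖ := by
  have : ‖u‖ ≤ ‖(c : 𝕜) • normSeries v‖ := norm_le_of_le_coord fun n => by
    rw [map_smul, norm_smul, norm_coord_normSeries, RCLike.norm_ofReal, abs_of_nonneg hc]
    exact h n
  rwa [norm_smul, RCLike.norm_ofReal, abs_of_nonneg hc] at this

variable (hf) in
/-- A sequence dominated by the coordinates of an element of `Y` belongs to `⨁_Y X`. -/
theorem exists_of_le_coord {x : ℕ → X} {y : Y} (h : ∀ n, ‖x n‖ ≤ ‖f.coord n y‖) :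
    ∃ u : BanachDirectSum X f hf, (∀ n, u n = x n) ∧ ‖u‖ ≤ ‖y‖ := by
  have hx : x ∈ banachDirectSumSubmodule X f hf :=
    hf.summable_of_le (a := fun n => f.coord n y) (fun n => by simpa using h n)
      (f.expansion y).summable
  exact ⟨⟨x, hx⟩, fun _ => rfl, norm_le_of_le_coord h⟩

theorem norm_apply_le (hn : ∀ n, ‖f n‖ = 1) (u : BanachDirectSum X f hf) (n : ℕ) :
    ‖u n‖ ≤ ‖u‖ :=
  (norm_coord_normSeries u n).symm.trans_le (SchauderBasis.norm_coord_le hf hn n _)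

section Single

theorem exists_single (hn : ∀ n, ‖f n‖ = 1) (n : ℕ) (x : X) :
    ∃ u : BanachDirectSum X f hf, (∀ k, u k = if k = n then x else 0) ∧ ‖u‖ ≤ ‖x‖ := by
  obtain ⟨u, hu, hun⟩ := exists_of_le_coord hf (x := fun k => if k = n then x else 0)
    (y := ((‖x‖ : ℝ) : 𝕜) • f n) (fun k => by
      by_cases h : k = n
      · subst h
        simp [SchauderBasis.coord_apply_self]
      · simpa [h] using by positivity)
  refine ⟨u, hu, ?_⟩
  simpa [norm_smul, hn] using hun

variable (hf) in
/-- The embedding of `X` as the `n`-th summand of `⨁_Y X`. -/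
noncomputable def single (hn : ∀ n, ‖f n‖ = 1) (n : ℕ) : X →L[𝕜] BanachDirectSum X f hf :=
  LinearMap.mkContinuous
    { toFun := fun x => (exists_single hn n x).choose
      map_add' := fun x y => ext fun k => by
        simp only [add_apply, (exists_single (hf := hf) hn n _).choose_spec.1]
        split_ifs <;> simp
      map_smul' := fun c x => ext fun k => by
        simp only [smul_apply, (exists_single (hf := hf) hn n _).choose_spec.1, RingHom.id_apply]
        split_ifs <;> simp } 1
    (fun x => by simpa using (exists_single (hf := hf) hn n x).choose_spec.2)

theorem single_apply (hn : ∀ n, ‖f n‖ = 1) (n : ℕ) (x : X) (k : ℕ) :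
    single hf hn n x k = if k = n then x else 0 :=
  (exists_single (hf := hf) hn n x).choose_spec.1 k

theorem norm_single_le (hn : ∀ n, ‖f n‖ = 1) (n : ℕ) (x : X) : ‖single hf hn n x‖ ≤ ‖x‖ :=
  (exists_single (hf := hf) hn n x).choose_spec.2

theorem sum_single_apply (hn : ∀ n, ‖f n‖ = 1) (N : ℕ) (x : ℕ → X) (k : ℕ) :
    (∑ n ∈ Finset.range N, single hf hn n (x n)) k = if k < N then x k else 0 := by
  simp [sum_apply, single_apply]

theorem tendsto_sum_single (hn : ∀ n, ‖f n‖ = 1) (u : BanachDirectSum X f hf) :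
    Tendsto (fun N => ∑ n ∈ Finset.range N, single hf hn n (u n)) atTop (𝓝 u) := by
  rw [tendsto_iff_norm_sub_tendsto_zero]
  have h := tendsto_iff_norm_sub_tendsto_zero.1 (SchauderBasis.tendsto_proj f (normSeries u))
  refine squeeze_zero (fun _ => norm_nonneg _) (fun N => ?_) h
  refine norm_le_of_le_coord fun k => ?_
  rw [sub_apply, sum_single_apply]
  by_cases hk : k < N <;>
    simp [hk, f.ortho, Pi.single_apply, norm_coord_normSeries]

/-- The sequences with finitely many nonzero terms, each of them with finitely many nonzero
coordinates, are dense in `⨁_Y X`. -/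
theorem dense_finite_support (hn : ∀ n, ‖f n‖ = 1) (e : SchauderBasis 𝕜 X) :
    Dense {u : BanachDirectSum X f hf |
      ∃ K, (∀ n ≥ K, u n = 0) ∧ ∀ n, ∀ i ≥ K, e.coord i (u n) = 0} := by
  intro u
  -- Double limit: truncate the sequence, then the expansion of each term.
  rw [← closure_closure]
  refine mem_closure_of_tendsto (tendsto_sum_single hn u) (Eventually.of_forall fun N => ?_)
  have h : Tendsto (fun K => ∑ n ∈ Finset.range N, single hf hn n (e.proj K (u n))) atTop
      (𝓝 (∑ n ∈ Finset.range N, single hf hn n (u n))) :=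
    tendsto_finsetSum _ fun n _ =>
      ((single hf hn n).continuous.tendsto _).comp (SchauderBasis.tendsto_proj e (u n))
  refine mem_closure_of_tendsto h (Eventually.of_forall fun K => ⟨max N K, ?_, ?_⟩)
  · intro n hn'
    rw [sum_single_apply hn N (fun n => e.proj K (u n)), if_neg (not_lt.2 (le_of_max_le_left hn'))]
  · intro n i hi
    rw [sum_single_apply hn N (fun n => e.proj K (u n))]
    have := not_lt.2 (le_of_max_le_right hi)
    split_ifs <;> simp [e.ortho, Pi.single_apply, this]

theorem separableSpace (hn : ∀ n, ‖f n‖ = 1) (e : SchauderBasis 𝕜 X) :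
    TopologicalSpace.SeparableSpace (BanachDirectSum X f hf) := by
  set S : Set (BanachDirectSum X f hf) :=
    Set.range fun p : ℕ × ℕ => single hf hn p.1 (e p.2) with hS
  have hSsep : TopologicalSpace.IsSeparable S := (Set.countable_range _).isSeparable
  have hspan := (hSsep.span (R := 𝕜)).closure
  rw [← TopologicalSpace.isSeparable_univ_iff]
  refine hspan.mono fun u _ => ?_
  rw [← closure_closure]
  refine mem_closure_of_tendsto (tendsto_sum_single hn u) (Eventually.of_forall fun N => ?_)
  have h : Tendsto (fun K => ∑ n ∈ Finset.range N, single hf hn n (e.proj K (u n))) atTop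
      (𝓝 (∑ n ∈ Finset.range N, single hf hn n (u n))) :=
    tendsto_finsetSum _ fun n _ =>
      ((single hf hn n).continuous.tendsto _).comp (SchauderBasis.tendsto_proj e (u n))
  refine mem_closure_of_tendsto h (Eventually.of_forall fun K => ?_)
  refine Submodule.sum_mem _ fun n _ => ?_
  simp only [SchauderBasis.proj_apply, map_sum, map_smul]
  exact Submodule.sum_mem _ fun i _ => Submodule.smul_mem _ _ (Submodule.subset_span ⟨(n, i), rfl⟩)

end Single

section Complete

variable [CompleteSpace X]

/-- The series `∑ₖ normSeries (u k)` converges absolutely in `Y`, and the coordinates of its sum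
dominate the coordinatewise sums in `X`. -/
theorem exists_hasSum_apply (hn : ∀ n, ‖f n‖ = 1) {u : ℕ → BanachDirectSum X f hf} (hu : Summable fun k => ‖u k‖) :
    ∃ x : BanachDirectSum X f hf, (∀ n, HasSum (fun k => u k n) (x n)) ∧
      ‖x‖ ≤ ∑' k, ‖u k‖ := by
  have hY : Summable fun k => normSeries (u k) := Summable.of_norm hu
  have hXn : ∀ n, Summable fun k => ‖u k n‖ := fun n =>
    Summable.of_nonneg_of_le (fun _ => norm_nonneg _) (fun k => norm_apply_le hn (u k) n) hu
  obtain ⟨x, hx, hxn⟩ := exists_of_le_coord hf (x := fun n => ∑' k, u k n)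
    (y := ∑' k, normSeries (u k)) (fun n => by
      rw [(f.coord n).map_tsum hY]
      simp only [coord_normSeries]
      rw [← RCLike.ofReal_tsum, RCLike.norm_ofReal]
      exact (norm_tsum_le_tsum_norm (hXn n)).trans (le_abs_self _))
  refine ⟨x, fun n => ?_, hxn.trans (norm_tsum_le_tsum_norm hu)⟩
  rw [hx]
  exact (hXn n).of_norm.hasSum

theorem completeSpace (hn : ∀ n, ‖f n‖ = 1) : CompleteSpace (BanachDirectSum X f hf) := by
  refine NormedAddCommGroup.completeSpace_of_summable_imp_tendsto fun u hu => ?_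
  obtain ⟨x, hx, -⟩ := exists_hasSum_apply hn hu
  refine ⟨x, ?_⟩
  rw [tendsto_iff_norm_sub_tendsto_zero]
  refine squeeze_zero (fun _ => norm_nonneg _) (fun N => ?_)
    (tendsto_sum_nat_add fun k => ‖u k‖)
  obtain ⟨z, hz, hzn⟩ := exists_hasSum_apply hn ((summable_nat_add_iff N).2 hu)
  refine le_of_eq_of_le ?_ hzn
  rw [norm_sub_rev]
  congr 1
  refine ext fun n => ?_
  rw [sub_apply, sum_apply, sub_eq_iff_eq_add', (hx n).tsum_eq.symm, (hz n).tsum_eq.symm]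
  exact ((hx n).summable.sum_add_tsum_nat_add N).symm

end Complete

/-- The image sequence is dominated by the coordinates of `K • B (normSeries u)`, where `B` is the
backward shift of `Y`. -/
theorem exists_weightedBackwardShift (hshift : HasContinuousBackwardShift f)
    (A : ℕ → X →L[𝕜] X) {K : ℝ} (hA : ∀ n v, ‖A n v‖ ≤ K * ‖v‖) :
    ∃ T : BanachDirectSum X f hf →L[𝕜] BanachDirectSum X f hf,
      ∀ u n, T u n = A n (u (n + 1)) := by
  obtain ⟨B, hB⟩ := hshift.exists_coord
  have hex : ∀ u : BanachDirectSum X f hf, ∃ w : BanachDirectSum X f hf,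
      (∀ n, w n = A n (u (n + 1))) ∧ ‖w‖ ≤ ‖(K : 𝕜) • B (normSeries u)‖ := by
    refine fun u => exists_of_le_coord hf fun n => ?_
    rw [map_smul, hB, norm_smul, norm_coord_normSeries, RCLike.norm_ofReal]
    exact (hA _ _).trans (mul_le_mul_of_nonneg_right (le_abs_self K) (norm_nonneg _))
  choose T hT hTn using hex
  refine ⟨LinearMap.mkContinuous
    { toFun := T
      map_add' := fun u v => ext fun n => by simp [add_apply, hT]
      map_smul' := fun c u => ext fun n => by simp [smul_apply, hT] } (|K| * ‖B‖)
    (fun u => (hTn u).trans ?_), fun u n => hT u n⟩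
  rw [norm_smul, RCLike.norm_ofReal, mul_assoc]
  exact mul_le_mul_of_nonneg_left (B.le_opNorm _) (abs_nonneg _)

end BanachDirectSum

/-! ### A Baire category criterion. -/

section Criterion

variable {𝕜 : Type*} [RCLike 𝕜] {E : Type*} [NormedAddCommGroup E] [NormedSpace 𝕜 E]

/-- If `T` is nilpotent at each point of a dense set `D` and each `y ∈ D` is approximated with
relative error `ε` by iterates, of arbitrarily large order, of arbitrarily small vectors, then `T`
is `δ`-hypercyclic for every `δ > ε`. -/
theorem isDeltaHypercyclic_of_dense [CompleteSpace E] [TopologicalSpace.SeparableSpace E]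
    {T : E →L[𝕜] E} {ε δ : ℝ} (hε : 0 < ε) (hδ : ε < δ) {D : Set E} (hD : Dense D)
    (hnil : ∀ x ∈ D, ∃ N, ∀ n ≥ N, (T ^ n) x = 0)
    (happrox : ∀ y ∈ D, ∀ η > 0, ∀ N, ∃ n ≥ N, ∃ x, ‖x‖ ≤ η ∧ ‖(T ^ n) x - y‖ ≤ ε * ‖y‖) :
    IsDeltaHypercyclic δ T := by
  have : SecondCountableTopology E := UniformSpace.secondCountable_of_separable E
  obtain ⟨D', hD'D, hD'c, hD'⟩ := hD.exists_countable_dense_subset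
  obtain ⟨δ', hεδ', hδ'δ⟩ := exists_between hδ
  let G : E → Set E := fun y => ⋃ n : ℕ, {x | ‖(T ^ n) x - y‖ < δ' * ‖y‖}
  have hGo : ∀ y ∈ D' \ {0}, IsOpen (G y) := fun y _ =>
    isOpen_iUnion fun n => isOpen_lt (by fun_prop) continuous_const
  have hGd : ∀ y ∈ D' \ {0}, Dense (G y) := by
    intro y hy
    rw [Metric.dense_iff]
    intro x₀ r hr
    obtain ⟨x₁, hx₁, hx₁D⟩ := Metric.dense_iff.1 hD x₀ (r / 2) (half_pos hr)
    obtain ⟨N, hN⟩ := hnil x₁ hx₁D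
    obtain ⟨n, hn, x, hx, hxy⟩ := happrox y (hD'D hy.1) (r / 3) (by positivity) N
    -- `Tⁿ` kills `x₁`, so adding it to the small vector `x` leaves the approximation of `y`
    -- unchanged.
    refine ⟨x₁ + x, ?_, Set.mem_iUnion.2 ⟨n, ?_⟩⟩
    · rw [Metric.mem_ball, dist_eq_norm] at hx₁ ⊢
      have := norm_add_le (x₁ - x₀) x
      rw [show x₁ + x - x₀ = x₁ - x₀ + x by abel]
      linarith
    · have hy0 : 0 < ‖y‖ := norm_pos_iff.2 hy.2
      rw [Set.mem_ofPred_eq, map_add, hN n hn, zero_add]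
      exact hxy.trans_lt (mul_lt_mul_of_pos_right hεδ' hy0)
  obtain ⟨x, hx⟩ := (dense_biInter_of_isOpen hGo (hD'c.mono Set.sdiff_subset) hGd).nonempty
  refine ⟨x, fun y hy => ?_⟩
  have hy0 : 0 < ‖y‖ := norm_pos_iff.2 hy
  -- Solves `δ' + κ (1 + δ') = δ`: the room left for replacing `y` by a point of `D'`.
  set κ := (δ - δ') / (1 + δ') with hκ
  have hδ'0 : 0 < δ' := hε.trans hεδ'
  have hκ0 : 0 < κ := div_pos (by linarith) (by linarith)
  obtain ⟨y', hy'b, hy'D⟩ := Metric.dense_iff.1 hD' y (min κ 1 * ‖y‖) (by positivity)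
  rw [Metric.mem_ball, dist_eq_norm] at hy'b
  have hb1 : ‖y' - y‖ < ‖y‖ :=
    hy'b.trans_le (mul_le_of_le_one_left hy0.le (min_le_right _ _))
  have hbκ : ‖y' - y‖ ≤ κ * ‖y‖ :=
    hy'b.le.trans (mul_le_mul_of_nonneg_right (min_le_left _ _) hy0.le)
  have hy'0 : y' ≠ 0 := by
    rintro rfl
    simp at hb1
  obtain ⟨n, hn⟩ := Set.mem_iUnion.1 (Set.mem_iInter₂.1 hx y' ⟨hy'D, hy'0⟩)
  refine ⟨n, ?_⟩
  rw [Set.mem_ofPred_eq] at hn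
  have h1 : ‖y'‖ ≤ ‖y‖ + κ * ‖y‖ := by
    have := norm_add_le y (y' - y)
    rw [add_sub_cancel] at this
    linarith
  calc ‖(T ^ n) x - y‖ ≤ ‖(T ^ n) x - y'‖ + ‖y' - y‖ := norm_sub_le_norm_sub_add_norm_sub _ _ _
    _ ≤ δ' * (‖y‖ + κ * ‖y‖) + κ * ‖y‖ := by gcongr; exact hn.le.trans (by gcongr)
    _ = (δ' + κ * (1 + δ')) * ‖y‖ := by ring
    _ = δ * ‖y‖ := by rw [hκ, div_mul_cancel₀ _ (by linarith)]; ring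

end Criterion

/-! ### The weighted shift and its two bounds. -/

namespace BanachDirectSum

variable {𝕜 : Type*} [RCLike 𝕜] {X : Type*} [NormedAddCommGroup X] [NormedSpace 𝕜 X]
  {Y : Type*} [NormedAddCommGroup Y] [NormedSpace 𝕜 Y] [CompleteSpace Y]
  {f : SchauderBasis 𝕜 Y} {hf : IsUnconditionalWith 𝕜 1 f}
  {T : BanachDirectSum X f hf →L[𝕜] BanachDirectSum X f hf}

/-- The iterates of the weighted backward shift with weights `Qₙ Pₙ₊₁`, where `Qₙ` is the inverse
of `Pₙ`. -/
theorem pow_apply_of_inverse {P Q : ℕ → X →L[𝕜] X} (hPQ : ∀ n v, P n (Q n v) = v)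
    (hQP : ∀ n v, Q n (P n v) = v) (hT : ∀ u n, T u n = Q n (P (n + 1) (u (n + 1))))
    (n : ℕ) (u : BanachDirectSum X f hf) (j : ℕ) :
    (T ^ n) u j = Q j (P (j + n) (u (j + n))) := by
  induction n generalizing j with
  | zero => exact (hQP j (u j)).symm
  | succ n ih =>
    rw [pow_succ', mul_apply_eq_comp, hT, ih, hPQ, add_right_comm, add_assoc]

/-- A weighted shift whose iterates badly approximate the multiples of a vector `z` of the first
summand is not `δ`-hypercyclic for small `δ`. -/
theorem not_isDeltaHypercyclic (hn : ∀ n, ‖f n‖ = 1) {z : X} (hz : ‖z‖ = 1) {ε δ : ℝ}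
    (hδ : δ < ε)
    (h : ∀ (u : BanachDirectSum X f hf) (n : ℕ) (b : 𝕜),
      ε * ‖b‖ - ‖u n‖ ≤ ‖(T ^ n) u 0 - b • z‖) : ¬ IsDeltaHypercyclic δ T := by
  rintro ⟨x, hx⟩
  -- So large that `(ε - δ) b` exceeds `‖x‖`, hence every `‖x n‖`.
  set b : ℝ := (‖x‖ + 1) / (ε - δ) with hb
  have hεδ : 0 < ε - δ := by linarith
  have hb0 : 0 < b := by positivity
  have hbn : ‖(b : 𝕜)‖ = b := by rw [RCLike.norm_ofReal, abs_of_pos hb0]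
  have hbz : ‖(b : 𝕜) • z‖ = b := by rw [norm_smul, hz, hbn, mul_one]
  have hs0 : single hf hn 0 ((b : 𝕜) • z) 0 = (b : 𝕜) • z := by
    rw [single_apply, if_pos rfl]
  have hsn : ‖single hf hn 0 ((b : 𝕜) • z)‖ = b := by
    refine le_antisymm ((norm_single_le hn _ _).trans_eq hbz) ?_
    have := norm_apply_le hn (single hf hn 0 ((b : 𝕜) • z)) 0
    rwa [hs0, hbz] at this
  obtain ⟨n, hxn⟩ := hx (single hf hn 0 ((b : 𝕜) • z)) (by
    intro h0
    rw [h0, norm_zero] at hsn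
    exact hb0.ne hsn)
  have h1 := h x n b
  have h2 := norm_apply_le hn ((T ^ n) x - single hf hn 0 ((b : 𝕜) • z)) 0
  rw [sub_apply, hs0] at h2
  rw [hsn] at hxn
  rw [hbn] at h1
  have h3 := norm_apply_le hn x n
  have h4 : (ε - δ) * b = ‖x‖ + 1 := by rw [hb]; field_simp
  linarith

variable {e : SchauderBasis 𝕜 X} {M : 𝕜} {s : ℕ → 𝕜}

/-- Supplies the approximation hypothesis of the Baire criterion: the corrected terms of `y` are
pulled back from times lying in one late stage. -/
theorem exists_pow_sub_le (hn : ∀ n, ‖f n‖ = 1) (he : IsUnconditionalWith 𝕜 1 e)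
    (hen : ∀ i, ‖e i‖ = 1) {ε : ℝ} (hε : 0 < ε) {a : ℕ → 𝕜}
    (ha : ∀ m, 0 < m → ‖-(1 - a m) • e 0 + (s m * a m) • e m‖ ≤ ε) (hs : ∀ m, 0 < m → s m ≠ 0)
    (hM : 1 ≤ ‖M‖) (hsM : ∀ m, 0 < m → 2 * ‖s m‖ ≤ ε * ‖M‖)
    (hT : ∀ (u : BanachDirectSum X f hf) (n j : ℕ), (T ^ n) u j =
      e.growthInv M s (stage j) (e.growth M s (stage (j + n)) (u (j + n))))
    {y : BanachDirectSum X f hf} {K : ℕ} (hyK : ∀ n ≥ K, y n = 0)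
    (hye : ∀ n, ∀ i ≥ K, e.coord i (y n) = 0) {η : ℝ} (hη : 0 < η) (N : ℕ) :
    ∃ n ≥ N, ∃ x, ‖x‖ ≤ η ∧ ‖(T ^ n) x - y‖ ≤ ε * ‖y‖ := by
  have hM0 : M ≠ 0 := norm_pos_iff.1 (by linarith)
  set C : ℝ := ∑ j ∈ Finset.range K, 4 * (‖e.growth M s (stage j)‖ * ((1 + ε) * ‖y j‖)) with hC
  -- `r ≥ 1` keeps the ages `j + r` positive, including at `j = 0`.
  obtain ⟨r, hrN, hr⟩ : ∃ r ≥ N + 1, (2⁻¹ : ℝ) ^ r * C ≤ η := by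
    have h : Tendsto (fun r : ℕ => (2⁻¹ : ℝ) ^ r * C) atTop (𝓝 (0 * C)) :=
      (tendsto_pow_atTop_nhds_zero_of_lt_one (by norm_num) (by norm_num)).mul_const C
    rw [zero_mul] at h
    obtain ⟨r, h1, h2⟩ := ((eventually_ge_atTop (N + 1)).and (h.eventually_le_const hη)).exists
    exact ⟨r, h1, h2⟩
  -- Large enough that the ages `j + r`, `j < K`, fit in stage `m`, that `y` has no `m`-th
  -- coordinates, and that `m` differs from the stages at times below `K`.
  set m := r + K + ∑ j ∈ Finset.range K, (stage j).2 + 1 with hm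
  have hm0 : 0 < m := by omega
  obtain ⟨n₀, hn₀⟩ := exists_stage_eq (r + K + ∑ j ∈ Finset.range K, (stage j).2)
  have hstage : ∀ j < K, stage (j + (n₀ + r)) = (j + r, m) := fun j hj => by
    rw [show j + (n₀ + r) = n₀ + (j + r) by ring]
    exact stage_add hn₀ _ (by omega)
  have hlt : ∀ j < K, (stage j).2 < m := fun j hj => by
    have := Finset.single_le_sum (f := fun j => (stage j).2) (fun _ _ => Nat.zero_le _)
      (Finset.mem_range.2 hj)
    omega
  have hex : ∀ j, ∃ y', j < K → ‖y' - y j‖ ≤ ε * ‖y j‖ ∧ e.coord m (e.growth M s (stage j) y') =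
      s m * e.coord 0 (e.growth M s (stage j) y') := fun j => by
    by_cases hj : j < K
    · obtain ⟨y', h⟩ := SchauderBasis.exists_coord_growth_eq he hen hm0 (ha m hm0) hM0 (hsM m hm0)
        (stage_snd_pos j) (hlt j hj).ne (hye j m (by omega))
      exact ⟨y', fun _ => h⟩
    · exact ⟨0, fun h => absurd h hj⟩
  choose y' hy' using hex
  let v : ℕ → X := fun j => e.growthInv M s (j + r, m) (e.growth M s (stage j) (y' j))
  have hv : ∀ j < K, ‖v j‖ ≤
      (2⁻¹) ^ r * (4 * (‖e.growth M s (stage j)‖ * ((1 + ε) * ‖y j‖))) := fun j hj => by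
    have h1 : ‖y' j‖ ≤ (1 + ε) * ‖y j‖ := by
      have := norm_add_le (y' j - y j) (y j)
      rw [sub_add_cancel] at this
      linarith [(hy' j hj).1]
    have h2 : ((2⁻¹ : ℝ)) ^ (j + r) ≤ (2⁻¹) ^ r :=
      pow_le_pow_of_le_one (by norm_num) (by norm_num) (by omega)
    calc ‖v j‖ ≤ 4 * (2⁻¹) ^ (j + r) * ‖e.growth M s (stage j) (y' j)‖ :=
          SchauderBasis.norm_growthInv_le he hen hM (by dsimp only; omega) (hs m hm0) (hy' j hj).2
      _ ≤ 4 * (2⁻¹) ^ r * (‖e.growth M s (stage j)‖ * ((1 + ε) * ‖y j‖)) := by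
          gcongr
          exact (ContinuousLinearMap.le_opNorm _ _).trans (by gcongr)
      _ = _ := by ring
  set x : BanachDirectSum X f hf :=
    ∑ j ∈ Finset.range K, single hf hn (j + (n₀ + r)) (v j) with hx
  have hxj : ∀ j, x (j + (n₀ + r)) = if j < K then v j else 0 := fun j => by
    simp [hx, sum_apply, single_apply]
  refine ⟨n₀ + r, by omega, x, ?_, ?_⟩
  · refine le_trans ?_ hr
    rw [hC, Finset.mul_sum]
    refine (norm_sum_le _ _).trans (Finset.sum_le_sum fun j hj => ?_)
    exact (norm_single_le hn _ _).trans (hv j (Finset.mem_range.1 hj))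
  · refine norm_le_mul_norm hε.le fun j => ?_
    rw [sub_apply, hT, hxj]
    split_ifs with hj
    · rw [hstage j hj, e.growth_growthInv hM0 hs hm0,
        e.growthInv_growth hM0 hs (stage_snd_pos j)]
      exact (hy' j hj).1
    · simp [hyK j (not_lt.1 hj)]

theorem exists_shift_of_norm_eq_one [CompleteSpace X] (he : IsUnconditionalWith 𝕜 1 e)
    (hen : ∀ i, ‖e i‖ = 1) (hn : ∀ n, ‖f n‖ = 1) (hshift : HasContinuousBackwardShift f)
    {ε : ℝ} (hε0 : 0 < ε) (hε1 : ε < 1) :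
    ∃ T : BanachDirectSum X f hf →L[𝕜] BanachDirectSum X f hf, IsWeightedBackwardShift T ∧
      (∀ δ < ε, ¬ IsDeltaHypercyclic δ T) ∧ ∀ δ > ε, IsDeltaHypercyclic δ T := by
  have hline : ∀ m, ∃ s a : 𝕜, 0 < m → ε ≤ ‖s‖ ∧ ‖s‖ ≤ ε / (1 - ε) ∧
      ‖-(1 - a) • e 0 + (s * a) • e m‖ ≤ ε ∧
      ∀ b c : 𝕜, ε * ‖b‖ ≤ ‖(b - c) • e 0 + (s * c) • e m‖ := fun m => by
    by_cases hm : 0 < m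
    · obtain ⟨s, a, h⟩ := SchauderBasis.exists_line_of_dist he hen hm hε0 hε1
      exact ⟨s, a, fun _ => h⟩
    · exact ⟨0, 0, fun h => absurd h hm⟩
  choose s a hsa using hline
  have h1ε : 0 < 1 - ε := by linarith
  -- With `|sₘ| ≤ ε / (1 - ε)`, the value `M = 2 / (1 - ε)` gives `2 |sₘ| ≤ ε |M|`.
  have hMn : ‖((2 / (1 - ε) : ℝ) : 𝕜)‖ = 2 / (1 - ε) := by
    rw [RCLike.norm_ofReal, abs_of_pos (by positivity)]
  generalize ((2 / (1 - ε) : ℝ) : 𝕜) = M at hMn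
  have hM1 : 1 ≤ ‖M‖ := by
    rw [hMn, le_div_iff₀ h1ε]
    linarith
  have hM0 : M ≠ 0 := norm_pos_iff.1 (by linarith)
  have hs0 : ∀ m, 0 < m → s m ≠ 0 := fun m hm =>
    norm_pos_iff.1 (hε0.trans_le (hsa m hm).1)
  obtain ⟨T, hT⟩ := exists_weightedBackwardShift (hf := hf) hshift
    (fun n => (e.growthInv M s (stage n)).comp (e.growth M s (stage (n + 1))))
    (fun n v => SchauderBasis.norm_growthInv_growth_stageNext_le he hen hM1 hε0
      (fun m hm => (hsa m hm).1) (fun m hm => (hsa m hm).2.1) (stage_snd_pos n) v)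
  have hpow : ∀ (u : BanachDirectSum X f hf) (n j : ℕ), (T ^ n) u j =
      e.growthInv M s (stage j) (e.growth M s (stage (j + n)) (u (j + n))) := fun u n j =>
    pow_apply_of_inverse (P := fun n => e.growth M s (stage n))
      (Q := fun n => e.growthInv M s (stage n))
      (fun n v => e.growth_growthInv hM0 hs0 (stage_snd_pos n) v)
      (fun n v => e.growthInv_growth hM0 hs0 (stage_snd_pos n) v) hT n u j
  have : CompleteSpace (BanachDirectSum X f hf) := completeSpace hn
  have : TopologicalSpace.SeparableSpace (BanachDirectSum X f hf) := separableSpace hn e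
  -- Weights are indexed from `1`, hence `n - 1`; the value at `0` plays no role.
  refine ⟨T, ⟨fun n => (e.growthInv M s (stage (n - 1))).comp (e.growth M s (stage n)), hT⟩,
    fun δ hδ => ?_, fun δ hδ => ?_⟩
  · refine not_isDeltaHypercyclic hn (hen 0) hδ fun u n b => ?_
    have h0 : ∀ v, e.growthInv M s (stage 0) v = v := fun v => by
      simp [SchauderBasis.growthInv, stage]
    rw [hpow, h0, zero_add]
    exact SchauderBasis.le_norm_smul_sub_growth he hen hε1.le (stage_snd_pos n)
      (hsa _ (stage_snd_pos n)).2.2.2 b (u n)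
  · refine isDeltaHypercyclic_of_dense hε0 hδ (dense_finite_support hn e) ?_ ?_
    · rintro u ⟨K, hK, -⟩
      refine ⟨K, fun n hnK => ext fun j => ?_⟩
      rw [hpow, hK (j + n) (by omega), map_zero, map_zero, zero_apply]
    · rintro y ⟨K, hyK, hye⟩ η hη N
      refine exists_pow_sub_le hn he hen hε0 (fun m hm => (hsa m hm).2.2.1) hs0 hM1
        (fun m hm => ?_) hpow hyK hye hη N
      rw [hMn]
      calc 2 * ‖s m‖ ≤ 2 * (ε / (1 - ε)) := by
            gcongr
            exact (hsa m hm).2.1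
        _ = ε * (2 / (1 - ε)) := by ring

end BanachDirectSum

theorem theorem1p1 {𝕜 : Type*} [RCLike 𝕜]
    {X : Type*} [NormedAddCommGroup X] [NormedSpace 𝕜 X] [CompleteSpace X]
    [TopologicalSpace.SeparableSpace X] (hX : ¬ FiniteDimensional 𝕜 X)
    (e : SchauderBasis 𝕜 X) (he : IsUnconditionalWith 𝕜 1 e)
    {Y : Type*} [NormedAddCommGroup Y] [NormedSpace 𝕜 Y] [CompleteSpace Y]
    [TopologicalSpace.SeparableSpace Y] (hY : ¬ FiniteDimensional 𝕜 Y)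
    (f : SchauderBasis 𝕜 Y) (hf : IsUnconditionalWith 𝕜 1 f) (hf_norm : ∀ n, ‖f n‖ = 1)
    (hf_shift : HasContinuousBackwardShift f)
    (ε : ℝ) (hε : ε ∈ Set.Ioo (0 : ℝ) 1) :
    ∃ T : BanachDirectSum X f hf →L[𝕜] BanachDirectSum X f hf,
      BanachDirectSum.IsWeightedBackwardShift T ∧
      (∀ δ ∈ Set.Ioo 0 ε, ¬ IsDeltaHypercyclic δ T) ∧
      (∀ δ ∈ Set.Ioo ε 1, IsDeltaHypercyclic δ T) := by
  -- The basis of `X` is not assumed normalized; rescaling it changes neither `X` nor the direct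
  -- sum.
  obtain ⟨T, hT, h1, h2⟩ := BanachDirectSum.exists_shift_of_norm_eq_one (hf := hf)
    (SchauderBasis.isUnconditionalWith_normalize he) e.norm_normalize hf_norm hf_shift hε.1 hε.2
  exact ⟨T, hT, fun δ hδ => h1 δ hδ.2, fun δ hδ => h2 δ hδ.1⟩
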